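/- For a finite simple graph $G$, let $\delta(G)$ denote its minimum degree. For two simple graphs $X$ and $Y$ with the same finite number of vertices, let $\mathsf{FS}(X,Y)$ be the graph whose vertices are all bijections $\sigma\colon V(X)\to V(Y)$, in which two bijections $\sigma$ and $\tau$ are adjacent if and only if there are distinct vertices $a,b\in V(X)$ such that $a$ and $b$ are adjacent in $X$, $\sigma(a)$ and $\sigma(b)$ are adjacent in $Y$, $\sigma(a)=\tau(b)$, $\sigma(b)=\tau(a)$, and $\sigma(c)=\tau(c)$ for all $c\in V(X)\setminus\{a,b\}$. **Theorem 1.5.** Let $X$ and $Y$ be connected simple graphs on $n$ vertices such that $$\min(\delta(X),\delta(Y))+2\max(\delta(X),\delta(Y))\ge 2n.$$ Then $\mathsf{FS}(X,Y)$ is connected. -/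

import Mathlib

/-- The friends-and-strangers graph of two simple graphs `X` and `Y`. Its vertices are the
bijections from the vertices of `X` to the vertices of `Y`; two bijections `σ` and `τ` are adjacent
when there are distinct vertices `a`, `b` of `X` such that `a`, `b` are adjacent in `X`,
`σ a`, `σ b` are adjacent in `Y`, and `τ` is obtained from `σ` by exchanging the values
at `a` and `b`. -/
def friendsAndStrangers {V W : Type*} (X : SimpleGraph V) (Y : SimpleGraph W) :
    SimpleGraph (V ≃ W) where
  Adj σ τ := ∃ a b : V, a ≠ b ∧ X.Adj a b ∧ Y.Adj (σ a) (σ b) ∧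
    σ a = τ b ∧ σ b = τ a ∧ ∀ c : V, c ≠ a → c ≠ b → σ c = τ c
  symm := ⟨by
    rintro σ τ ⟨a, b, hab, hX, hY, h1, h2, h3⟩
    refine ⟨a, b, hab, hX, ?_, h2.symm, h1.symm, fun c ha hb => (h3 c ha hb).symm⟩
    rw [← h1, ← h2]
    exact hY.symm⟩
  loopless := ⟨by
    rintro σ ⟨a, b, hab, -, -, h1, -, -⟩
    exact hab (σ.injective h1)⟩

/-!
Think of `σ : V ≃ W` as placing the people `W` on the positions `V`; a move exchanges two friends
standing on adjacent positions. As the transpositions of the edges of the connected graph `X`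
generate the symmetric group, it suffices to show that for every arrangement `σ` and every edge
`x y` of `X` the people `u = σ x` and `v = σ y` can be exchanged, everybody else ending up where
they started (`reachable_of_forall_reachable_swap`). This is one move if `u`, `v` are friends, so
suppose they are not. Two configurations around the edge `x y` permit the exchange, each by an
explicit short word of moves:

* two neighbours of `x` hold common friends of `u` and `v` who are friends of each other
  (`reachable_swap_of_star`);
* a common neighbour of `x` and `y` holds a friend `b` of `v`, and two neighbours of `x` hold common
  friends of `u` and `v`, one of them a friend of `b` (`reachable_swap_of_triangle_star`).

By symmetry `x` and `y`, or `u` and `v`, may be interchanged. With the larger minimum degree on `Y`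
and `d = |W| - δ(Y)`, every position has at least `2 d` neighbours and every person has at most `d`
non-friends, themselves included. Hence common friends `w` and `w'` of `u` and `v` stand next to `x`
and to `y` respectively. If neither of the configurations occurs, then `w` and `w'` have so many
non-friends that every person is a neighbour of `x` and `y` at most as often as they are a non-friend
of `u`, `v`, `w` and `w'`, with a surplus at `u` and at `v`. Summing over all people gives
`4 d + 2 ≤ 4 d`, a contradiction (`reachable_swap_of_degree`).
-/

open Equiv

/-- The graph on `Fin k` whose edges are the pairs in the list `l`. -/
def listGraph {k : ℕ} (l : List (Fin k × Fin k)) : SimpleGraph (Fin k) :=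
  SimpleGraph.fromRel fun i j => (i, j) ∈ l

instance {k : ℕ} (l : List (Fin k × Fin k)) : DecidableRel (listGraph l).Adj :=
  inferInstanceAs (DecidableRel (SimpleGraph.fromRel fun i j => (i, j) ∈ l).Adj)

theorem listGraph_le {k : ℕ} {l : List (Fin k × Fin k)} {G : SimpleGraph (Fin k)}
    (h : ∀ e ∈ l, G.Adj e.1 e.2) : listGraph l ≤ G := by
  intro i j hij
  rcases ((SimpleGraph.fromRel_adj _ _ _).1 hij).2 with h' | h'
  · exact h _ h'
  · exact (h _ h').symm

/-- `LegalWord X Y π l` says that, starting from the arrangement `π`, the swaps along the pairs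
of positions in `l` can be carried out in order, each being a move of
`friendsAndStrangers X Y`. -/
def LegalWord {α : Type*} [DecidableEq α] (X Y : SimpleGraph α) :
    Perm α → List (α × α) → Prop
  | _, [] => True
  | π, e :: l => X.Adj e.1 e.2 ∧ Y.Adj (π e.1) (π e.2) ∧ LegalWord X Y (π * swap e.1 e.2) l

instance LegalWord.decidable {α : Type*} [DecidableEq α] (X Y : SimpleGraph α)
    [DecidableRel X.Adj] [DecidableRel Y.Adj] :
    ∀ (π : Perm α) (l : List (α × α)), Decidable (LegalWord X Y π l)
  | _, [] => inferInstanceAs (Decidable True)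
  | π, e :: l =>
    have := LegalWord.decidable X Y (π * swap e.1 e.2) l
    inferInstanceAs (Decidable (_ ∧ _ ∧ _))

/-! ### Moves and exchanges -/

section Moves

variable {V W : Type*} {X : SimpleGraph V} {Y : SimpleGraph W}

theorem friendsAndStrangers_adj_swap [DecidableEq V] {σ : V ≃ W} {a b : V} (hX : X.Adj a b)
    (hY : Y.Adj (σ a) (σ b)) : (friendsAndStrangers X Y).Adj σ ((swap a b).trans σ) :=
  ⟨a, b, hX.ne, hX, hY, by simp, by simp, fun c ha hb => by
    simp [swap_apply_of_ne_of_ne ha hb]⟩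

theorem LegalWord.reachable {α : Type*} [DecidableEq α] {X Y : SimpleGraph α} {π : Perm α}
    {l : List (α × α)} (h : LegalWord X Y π l) :
    (friendsAndStrangers X Y).Reachable π (π * (l.map fun e => swap e.1 e.2).prod) := by
  induction l generalizing π with
  | nil => simp
  | cons e l ih =>
    obtain ⟨hX, hY, hl⟩ := h
    have h1 : (friendsAndStrangers X Y).Reachable π (π * swap e.1 e.2) :=
      (friendsAndStrangers_adj_swap hX hY).reachable
    simpa [mul_assoc] using h1.trans (ih hl)

/-- A path in the friends-and-strangers graph of two graphs on a small model set `α` transports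
along an embedding of `α` into the positions, provided that the two model graphs are carried to
edges of `X` (by the embedding) and of `Y` (by the people standing there). -/
theorem reachable_of_model [DecidableEq V] {α : Type*} {X' Y' : SimpleGraph α} (p : α ↪ V)
    (σ : V ≃ W) (hX : X' ≤ X.comap p) (hY : Y' ≤ Y.comap (σ ∘ p)) {π π' : Perm α}
    (h : (friendsAndStrangers X' Y').Reachable π π') :
    (friendsAndStrangers X Y).Reachable ((π.viaEmbedding p).trans σ)
      ((π'.viaEmbedding p).trans σ) := by
  let f : friendsAndStrangers X' Y' →g friendsAndStrangers X Y :=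
    { toFun := fun π => (Perm.viaEmbedding π p).trans σ
      map_rel' := by
        rintro π π' ⟨a, b, hab, h1, h2, h3, h4, h5⟩
        refine ⟨p a, p b, p.injective.ne hab, hX h1, ?_, ?_, ?_, ?_⟩
        · simpa [Perm.viaEmbedding_apply] using hY h2
        · simp [Perm.viaEmbedding_apply, h3]
        · simp [Perm.viaEmbedding_apply, h4]
        · intro c ha hb
          by_cases hc : c ∈ Set.range p
          · obtain ⟨c, rfl⟩ := hc
            simp [Perm.viaEmbedding_apply, h5 c (fun h => ha (h ▸ rfl)) (fun h => hb (h ▸ rfl))]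
          · simp [Perm.viaEmbedding_apply_of_notMem _ _ _ hc] }
  exact h.map f

theorem viaEmbedding_swap [DecidableEq V] {α : Type*} [DecidableEq α] (p : α ↪ V) (a b : α) :
    (swap a b).viaEmbedding p = swap (p a) (p b) := by
  ext c
  by_cases hc : c ∈ Set.range p
  · obtain ⟨c, rfl⟩ := hc
    rw [Perm.viaEmbedding_apply, p.injective.swap_apply]
  · rw [Perm.viaEmbedding_apply_of_notMem _ _ _ hc, swap_apply_of_ne_of_ne]
    · rintro rfl; exact hc ⟨a, rfl⟩
    · rintro rfl; exact hc ⟨b, rfl⟩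

/-- If a legal word in a model on `Fin (k + 2)` multiplies out to the transposition of `0` and `1`,
then the people at the images of `0` and `1` can be exchanged, everybody else ending up in
place. -/
theorem reachable_swap_of_word [DecidableEq V] {k : ℕ} (lX lY w : List (Fin (k + 2) × Fin (k + 2)))
    (hw : LegalWord (listGraph lX) (listGraph lY) 1 w)
    (hprod : (w.map fun e => swap e.1 e.2).prod = swap 0 1)
    (p : Fin (k + 2) → V) (hp : Function.Injective p) (σ : V ≃ W)
    (hX : ∀ e ∈ lX, X.Adj (p e.1) (p e.2)) (hY : ∀ e ∈ lY, Y.Adj (σ (p e.1)) (σ (p e.2))) :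
    (friendsAndStrangers X Y).Reachable σ ((swap (p 0) (p 1)).trans σ) := by
  have h := reachable_of_model (X := X) (Y := Y) ⟨p, hp⟩ σ (listGraph_le fun e he => hX e he)
    (listGraph_le fun e he => hY e he) hw.reachable
  rw [hprod, one_mul, viaEmbedding_swap] at h
  have h1 : (1 : Perm (Fin (k + 2))).viaEmbedding ⟨p, hp⟩ = 1 :=
    map_one (Perm.viaEmbeddingHom ⟨p, hp⟩)
  rw [h1] at h
  exact h

variable [DecidableEq V] {σ : V ≃ W} {x y z z₁ z₂ : V}

/-- Exchange inside a star of `X` with centre `x` and leaves `y`, `z₁`, `z₂`, when all pairs of the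
four people standing there, except possibly those at `x` and `y`, are friends. -/
theorem reachable_swap_of_star (hxy : X.Adj x y) (h₁ : X.Adj x z₁) (h₂ : X.Adj x z₂)
    (hx₁ : Y.Adj (σ x) (σ z₁)) (hx₂ : Y.Adj (σ x) (σ z₂)) (hy₁ : Y.Adj (σ y) (σ z₁))
    (hy₂ : Y.Adj (σ y) (σ z₂)) (h₁₂ : Y.Adj (σ z₁) (σ z₂)) :
    (friendsAndStrangers X Y).Reachable σ ((swap x y).trans σ) := by
  refine reachable_swap_of_word (k := 2) [(0, 1), (0, 2), (0, 3)]
    [(0, 2), (1, 2), (0, 3), (1, 3), (2, 3)]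
    [(0, 2), (0, 1), (0, 3), (0, 1), (0, 2), (0, 1), (0, 3)] (by decide) (by decide)
    ![x, y, z₁, z₂] ?_ σ ?_ ?_
  · intro i j hij
    have := hxy.ne; have := h₁.ne; have := h₂.ne
    have := ne_of_apply_ne σ hy₁.ne; have := ne_of_apply_ne σ hy₂.ne
    have := ne_of_apply_ne σ h₁₂.ne
    fin_cases i <;> fin_cases j <;> simp_all
  · simp [hxy, h₁, h₂]
  · simp [hx₁, hx₂, hy₁, hy₂, h₁₂]

/-- Exchange through a triangle `x y z` of `X` whose third person need only be a friend of the
person at `y`, with the help of two further neighbours `z₁`, `z₂` of `x`, holding friends of both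
people to be exchanged, the first of them also a friend of the person at `z`. -/
theorem reachable_swap_of_triangle_star (hxy : X.Adj x y) (hxz : X.Adj x z) (hyz : X.Adj y z)
    (h₁ : X.Adj x z₁) (h₂ : X.Adj x z₂) (h₁₂ : z₁ ≠ z₂) (hz₂ : z ≠ z₂)
    (hx₁ : Y.Adj (σ x) (σ z₁)) (hx₂ : Y.Adj (σ x) (σ z₂)) (hy₁ : Y.Adj (σ y) (σ z₁))
    (hy₂ : Y.Adj (σ y) (σ z₂)) (hy : Y.Adj (σ y) (σ z)) (hz₁ : Y.Adj (σ z) (σ z₁)) :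
    (friendsAndStrangers X Y).Reachable σ ((swap x y).trans σ) := by
  refine reachable_swap_of_word (k := 3) [(0, 1), (0, 2), (1, 2), (0, 3), (0, 4)]
    [(0, 3), (0, 4), (1, 3), (1, 4), (1, 2), (2, 3)]
    [(1, 2), (0, 4), (0, 2), (0, 1), (0, 3), (0, 1), (0, 2), (0, 4), (0, 1), (0, 3), (0, 2)]
    (by decide) (by decide) ![x, y, z, z₁, z₂] ?_ σ ?_ ?_
  · intro i j hij
    have := hxy.ne; have := hxz.ne; have := hyz.ne; have := h₁.ne; have := h₂.ne
    have := ne_of_apply_ne σ hy₁.ne; have := ne_of_apply_ne σ hy₂.ne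
    have := ne_of_apply_ne σ hz₁.ne
    fin_cases i <;> fin_cases j <;> simp_all
  · simp [hxy, hxz, hyz, h₁, h₂]
  · simp [hx₁, hx₂, hy₁, hy₂, hy, hz₁]

/-- The exchange problem for the edge `x y` started from the exchanged arrangement is the original
problem read backwards. -/
theorem reachable_swap_symm
    (h : (friendsAndStrangers X Y).Reachable ((swap x y).trans σ)
      ((swap x y).trans ((swap x y).trans σ))) :
    (friendsAndStrangers X Y).Reachable σ ((swap x y).trans σ) := by
  rw [← Equiv.trans_assoc, ← Perm.mul_def, swap_mul_self, Perm.one_def, Equiv.refl_trans] at h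
  exact h.symm

/-- If from every arrangement the people on every edge of the connected graph `X` can be exchanged,
then all arrangements are mutually reachable, since the transpositions of the edges of a connected
graph generate the symmetric group. -/
theorem reachable_of_forall_reachable_swap [Finite V] (hX : X.Connected)
    (h : ∀ (σ : V ≃ W) (x y : V), X.Adj x y →
      (friendsAndStrangers X Y).Reachable σ ((swap x y).trans σ)) (σ τ : V ≃ W) :
    (friendsAndStrangers X Y).Reachable σ τ := by
  have hwalk : ∀ (x y : V), X.Walk x y → ∀ σ : V ≃ W,
      (friendsAndStrangers X Y).Reachable σ ((swap x y).trans σ) := by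
    intro x y w
    induction w with
    | nil => intro σ; simp
    | @cons a b c hab w ih =>
      intro σ
      by_cases hac : a = c
      · subst hac; simp
      by_cases hbc : b = c
      · subst hbc; exact h σ _ _ hab
      -- conjugation: `(a c) = (a b) (b c) (a b)`
      have key : swap a c = swap a b * swap b c * swap a b := by
        rw [swap_comm a b, swap_comm b c, swap_mul_swap_mul_swap (Ne.symm hbc) (Ne.symm hac)]
      have := ((h σ a b hab).trans (ih _)).trans (h _ a b hab)
      rw [key]
      simpa [Perm.mul_def, Equiv.trans_assoc] using this
  have hperm : ∀ (π : Perm V) (σ : V ≃ W),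
      (friendsAndStrangers X Y).Reachable σ (π.trans σ) := by
    intro π
    induction π using Perm.swap_induction_on with
    | one => intro σ; exact SimpleGraph.Reachable.refl _
    | swap_mul π x y hxy ih =>
      intro σ
      obtain ⟨w⟩ := hX.preconnected x y
      exact (hwalk x y w σ).trans (ih _)
  have := hperm (τ.trans σ.symm) σ
  simpa [Equiv.trans_assoc] using this

end Moves

/-! ### Counting non-friends -/

section Counting

/-- If the people at `x` and `y` cannot be exchanged, then a common friend `σ z₁` of theirs standing
next to `x` is not a friend of any other common friend standing next to `x`, nor of anybody standing
next to both `x` and `y` who is a friend of one of the two. -/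
theorem not_adj_of_not_reachable_swap {V W : Type*} [DecidableEq V] {X : SimpleGraph V}
    {Y : SimpleGraph W} {σ : V ≃ W} {x y z₁ z₂ z : V} (hxy : X.Adj x y)
    (h : ¬ (friendsAndStrangers X Y).Reachable σ ((swap x y).trans σ))
    (h₁ : X.Adj x z₁) (hx₁ : Y.Adj (σ x) (σ z₁)) (hy₁ : Y.Adj (σ y) (σ z₁))
    (h₂ : X.Adj x z₂) (hx₂ : Y.Adj (σ x) (σ z₂)) (hy₂ : Y.Adj (σ y) (σ z₂)) (h₁₂ : z₁ ≠ z₂)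
    (hxz : X.Adj x z)
    (hz : Y.Adj (σ x) (σ z) ∧ Y.Adj (σ y) (σ z) ∨
      X.Adj y z ∧ (Y.Adj (σ x) (σ z) ∨ Y.Adj (σ y) (σ z))) :
    ¬ Y.Adj (σ z₁) (σ z) := by
  intro hz₁
  by_cases hb : Y.Adj (σ x) (σ z) ∧ Y.Adj (σ y) (σ z)
  · exact h (reachable_swap_of_star hxy h₁ hxz hx₁ hb.1 hy₁ hb.2 hz₁)
  obtain ⟨hyz, hz⟩ := hz.resolve_left hb
  have hz₂ : z ≠ z₂ := by rintro rfl; exact hb ⟨hx₂, hy₂⟩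
  rcases hz with hz | hz
  · -- the person at `z` is a friend of the one at `x` only: run the exchange backwards
    apply h
    apply reachable_swap_symm
    have e : ∀ c, X.Adj x c → c ≠ y → (swap x y).trans σ c = σ c := fun c hc hcy => by
      simp [swap_apply_of_ne_of_ne hc.ne' hcy]
    have e₁ := e z₁ h₁ (ne_of_apply_ne σ hy₁.ne')
    have e₂ := e z₂ h₂ (ne_of_apply_ne σ hy₂.ne')
    have e₃ := e z hxz hyz.ne'
    have ex : (swap x y).trans σ x = σ y := by simp
    have ey : (swap x y).trans σ y = σ x := by simp
    apply reachable_swap_of_triangle_star hxy hxz hyz h₁ h₂ h₁₂ hz₂ <;>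
      simp only [*]
    exact hz₁.symm
  · exact h (reachable_swap_of_triangle_star hxy hxz hyz h₁ h₂ h₁₂ hz₂ hx₁ hx₂ hy₁ hy₂ hz hz₁.symm)

variable {V W : Type*} [Fintype V] [Fintype W] {X : SimpleGraph V} {Y : SimpleGraph W}
  [DecidableRel X.Adj] [DecidableRel Y.Adj] {d : ℕ} {σ : V ≃ W} {x y : V}

theorem sum_adj_symm_eq_degree (σ : V ≃ W) (x : V) :
    ∑ t : W, (if X.Adj x (σ.symm t) then 1 else 0) = X.degree x := by
  rw [← X.card_neighborFinset_eq_degree, ← Equiv.sum_comp σ]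
  simp [SimpleGraph.neighborFinset_eq_filter]

theorem sum_not_adj_add_degree (s : W) :
    ∑ t : W, (if ¬ Y.Adj s t then 1 else 0) + Y.degree s = Fintype.card W := by
  rw [← sum_adj_symm_eq_degree (Equiv.refl W) s, ← Finset.sum_add_distrib]
  trans ∑ t : W, 1
  · refine Finset.sum_congr rfl fun t _ => ?_
    by_cases h : Y.Adj s t <;> simp [h]
  · simp

/-- Among the people standing next to `x`, at least two are friends of both the person at `x` and
the person at the neighbour `y` of `x`. -/
theorem exists_ne_common_friend (hXd : ∀ a, 2 * d ≤ X.degree a)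
    (hYd : ∀ s, ∑ t : W, (if ¬ Y.Adj s t then 1 else 0) ≤ d) (hxy : X.Adj x y)
    (hn : ¬ Y.Adj (σ x) (σ y)) (w : W) :
    ∃ t ≠ w, X.Adj x (σ.symm t) ∧ Y.Adj (σ x) t ∧ Y.Adj (σ y) t := by
  classical
  by_contra! hc
  have hxyσ : σ x ≠ σ y := σ.injective.ne hxy.ne
  have hn' : ¬ Y.Adj (σ y) (σ x) := fun h => hn h.symm
  -- Both `σ x` and `σ y` are non-friends of each other and of themselves, while `σ x` does not
  -- stand next to `x`, so `σ x` may be added twice and `σ y` once on the left.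
  have key : ∑ t : W, ((if X.Adj x (σ.symm t) then 1 else 0) + (if t = σ x then 1 else 0)
        + (if t = σ x then 1 else 0) + (if t = σ y then 1 else 0))
      ≤ ∑ t : W, ((if ¬ Y.Adj (σ x) t then 1 else 0) + (if ¬ Y.Adj (σ y) t then 1 else 0)
        + (if t = w then 1 else 0)) := by
    refine Finset.sum_le_sum fun t _ => ?_
    by_cases hx : t = σ x
    · subst hx; simp [hn', hxyσ]
    by_cases hy : t = σ y
    · subst hy; simp [hn, hxy, hxyσ.symm]
    have := hc t
    grind
  simp only [Finset.sum_add_distrib, sum_adj_symm_eq_degree, Finset.sum_ite_eq', Finset.mem_univ,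
    if_true] at key
  have := hXd x; have := hYd (σ x); have := hYd (σ y)
  omega

/-- The counting argument: if every position has at least `2 * d` neighbours and every person has at
most `d` non-friends, themselves included, then the people on any edge of `X` can be exchanged. -/
theorem reachable_swap_of_degree [DecidableEq V] (hXd : ∀ a, 2 * d ≤ X.degree a)
    (hYd : ∀ s, ∑ t : W, (if ¬ Y.Adj s t then 1 else 0) ≤ d) (hxy : X.Adj x y) :
    (friendsAndStrangers X Y).Reachable σ ((swap x y).trans σ) := by
  classical
  by_cases hn : Y.Adj (σ x) (σ y)
  · exact (friendsAndStrangers_adj_swap hxy hn).reachable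
  by_contra h
  have h' : ¬ (friendsAndStrangers X Y).Reachable σ ((swap y x).trans σ) := by
    rwa [swap_comm]
  have hn' : ¬ Y.Adj (σ y) (σ x) := fun h => hn h.symm
  have hxyσ : σ x ≠ σ y := σ.injective.ne hxy.ne
  obtain ⟨w, -, hw, hwx, hwy⟩ := exists_ne_common_friend hXd hYd hxy hn (σ x)
  obtain ⟨w', -, hw', hwy', hwx'⟩ := exists_ne_common_friend hXd hYd hxy.symm hn' (σ x)
  obtain ⟨s, hs, hsx, hsu, hsv⟩ := exists_ne_common_friend hXd hYd hxy hn w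
  obtain ⟨s', hs', hsy', hsv', hsu'⟩ := exists_ne_common_friend hXd hYd hxy.symm hn' w'
  have hW : ∀ t, X.Adj x (σ.symm t) → (Y.Adj (σ x) t ∧ Y.Adj (σ y) t ∨
      X.Adj y (σ.symm t) ∧ (Y.Adj (σ x) t ∨ Y.Adj (σ y) t)) → ¬ Y.Adj w t := by
    intro t ht ht'
    simpa using not_adj_of_not_reachable_swap (z₁ := σ.symm w) (z₂ := σ.symm s) (z := σ.symm t)
      hxy h hw (by simpa) (by simpa) hsx (by simpa) (by simpa) (by simpa using hs.symm) ht
      (by simpa)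
  have hW' : ∀ t, X.Adj y (σ.symm t) → (Y.Adj (σ y) t ∧ Y.Adj (σ x) t ∨
      X.Adj x (σ.symm t) ∧ (Y.Adj (σ y) t ∨ Y.Adj (σ x) t)) → ¬ Y.Adj w' t := by
    intro t ht ht'
    simpa using not_adj_of_not_reachable_swap (z₁ := σ.symm w') (z₂ := σ.symm s') (z := σ.symm t)
      hxy.symm h' hw' (by simpa) (by simpa) hsy' (by simpa) (by simpa) (by simpa using hs'.symm) ht
      (by simpa)
  -- Pointwise bound: a common friend of `σ x`, `σ y` counted on the left is a non-friend of `w`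
  -- (next to `x`) or of `w'` (next to `y`); a friend of just one of them is counted once on the
  -- right for the other, and, if next to both `x` and `y`, once more for `w`; anybody else is
  -- counted twice on the right. The terms for `t = σ x`, `σ y` supply the strict inequality.
  have key : ∑ t : W, ((if X.Adj x (σ.symm t) then 1 else 0)
        + (if X.Adj y (σ.symm t) then 1 else 0)
        + (if t = σ x then 1 else 0) + (if t = σ y then 1 else 0))
      ≤ ∑ t : W, ((if ¬ Y.Adj (σ x) t then 1 else 0) + (if ¬ Y.Adj (σ y) t then 1 else 0)
        + (if ¬ Y.Adj w t then 1 else 0) + (if ¬ Y.Adj w' t then 1 else 0)) := by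
    refine Finset.sum_le_sum fun t _ => ?_
    by_cases hx : t = σ x
    · subst hx; simp [hn', hxyσ, hxy.symm]; omega
    by_cases hy : t = σ y
    · subst hy; simp [hn, hxy, hxyσ.symm]; omega
    have h1 := hW t
    have h2 := hW' t
    grind
  simp only [Finset.sum_add_distrib, sum_adj_symm_eq_degree, Finset.sum_ite_eq', Finset.mem_univ,
    if_true] at key
  have := hXd x; have := hXd y; have := hYd (σ x); have := hYd (σ y); have := hYd w
  have := hYd w'
  omega

/-- The connectedness criterion with the two graphs in a fixed order. -/
theorem friendsAndStrangers_connected_of_le (hcard : Fintype.card V = Fintype.card W)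
    (hX : X.Connected) (hdeg : 2 * Fintype.card W ≤ X.minDegree + 2 * Y.minDegree) :
    (friendsAndStrangers X Y).Connected := by
  classical
  have hne : Nonempty (V ≃ W) := Fintype.card_eq.1 hcard
  refine { preconnected := reachable_of_forall_reachable_swap hX fun σ x y hxy =>
    reachable_swap_of_degree (d := Fintype.card W - Y.minDegree) ?_ ?_ hxy }
  · intro a
    have := X.minDegree_le_degree a
    omega
  · intro s
    have := sum_not_adj_add_degree (Y := Y) s
    have := Y.minDegree_le_degree s
    omega

end Counting

theorem friendsAndStrangers_connected_comm {V W : Type*} {X : SimpleGraph V} {Y : SimpleGraph W}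
    (h : (friendsAndStrangers X Y).Connected) : (friendsAndStrangers Y X).Connected := by
  let f : friendsAndStrangers X Y →g friendsAndStrangers Y X :=
    { toFun := Equiv.symm
      map_rel' := by
        rintro σ τ ⟨a, b, hab, hX, hY, h1, h2, h3⟩
        refine ⟨σ a, σ b, σ.injective.ne hab, hY, by simpa, ?_, ?_, fun c hca hcb => ?_⟩
        · rw [h2]; simp
        · rw [h1]; simp
        · have := h3 (σ.symm c) (fun e => hca (by simp [← e])) (fun e => hcb (by simp [← e]))
          rw [Equiv.eq_symm_apply, ← this]; simp }
  exact h.map f fun σ => ⟨σ.symm, rfl⟩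

theorem theorem1p5 {V W : Type*} [Fintype V] [Fintype W] (n : ℕ)
    (hV : Fintype.card V = n) (hW : Fintype.card W = n)
    (X : SimpleGraph V) (Y : SimpleGraph W) [DecidableRel X.Adj] [DecidableRel Y.Adj]
    (hX : X.Connected) (hY : Y.Connected)
    (hdeg : 2 * n ≤ min X.minDegree Y.minDegree + 2 * max X.minDegree Y.minDegree) :
    (friendsAndStrangers X Y).Connected := by
  rcases le_total X.minDegree Y.minDegree with h | h
  · rw [min_eq_left h, max_eq_right h] at hdeg
    exact friendsAndStrangers_connected_of_le (hV.trans hW.symm) hX (hW.symm ▸ hdeg)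
  · rw [min_eq_right h, max_eq_left h] at hdeg
    exact friendsAndStrangers_connected_comm
      (friendsAndStrangers_connected_of_le (hW.trans hV.symm) hY (hV.symm ▸ hdeg))
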